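/- Let $E$ be a real Banach lattice with order continuous norm (i.e. $\|x_\alpha\|\to 0$ for every net $x_\alpha\downarrow 0$ in $E$). Then every closed linear subspace $X$ of $E$ has property weak (V$^*$): every V$^*$-set $K\subseteq X$ is weakly precompact, that is, every sequence in $K$ has a weakly Cauchy subsequence. Here a bounded subset $K$ of a real Banach space $X$ is called a V$^*$-set if $\sup_{x\in K}|x_n'(x)|\to 0$ as $n\to\infty$ for every weakly unconditionally Cauchy series $\sum_n x_n'$ in the dual $X'$, i.e. for every sequence $(x_n')$ in $X'$ with $\sum_n|x''(x_n')|<\infty$ for all $x''\in X''$. -/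

import Mathlib

open Filter Topology

/-- A normed lattice has order continuous norm if `‖x_α‖ → 0` for every net `x_α ↓ 0`.
Equivalently (a decreasing net being the same thing as a downward directed set here): every
nonempty downward directed set `A` with infimum `0` satisfies `inf {‖a‖ : a ∈ A} = 0`. -/
def HasOrderContinuousNorm (E : Type*) [NormedAddCommGroup E] [Lattice E] : Prop :=
  ∀ A : Set E, A.Nonempty → DirectedOn (fun x y => x ≥ y) A → IsGLB A 0 →
    IsGLB ((fun a => ‖a‖) '' A) 0

/-- The series `∑ x n` is weakly unconditionally Cauchy: `∑ |f (x n)| < ∞` for every `f` in the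
dual of `X`. -/
def IsWeaklyUnconditionallyCauchy {X : Type*} [NormedAddCommGroup X] [NormedSpace ℝ X]
    (x : ℕ → X) : Prop :=
  ∀ f : StrongDual ℝ X, Summable fun n => |f (x n)|

/-- `K` is a V*-set: it is bounded and `sup_{x ∈ K} |x'_n(x)| → 0` for every weakly unconditionally
Cauchy series `∑ x'_n` in the dual of `X`. (By boundedness the supremum is a genuine one; it is
`0` when `K` is empty.) -/
def IsVStarSet {X : Type*} [NormedAddCommGroup X] [NormedSpace ℝ X] (K : Set X) : Prop :=
  Bornology.IsBounded K ∧
    ∀ x' : ℕ → StrongDual ℝ X, IsWeaklyUnconditionallyCauchy x' →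
      Tendsto (fun n => ⨆ x : K, |x' n (x : X)|) atTop (𝓝 0)

/-- A sequence is weakly Cauchy if every continuous linear functional maps it to a Cauchy
sequence. -/
def IsWeaklyCauchySeq {X : Type*} [NormedAddCommGroup X] [NormedSpace ℝ X] (x : ℕ → X) : Prop :=
  ∀ f : StrongDual ℝ X, CauchySeq fun n => f (x n)

/-- `K` is weakly precompact (weakly conditionally compact): every sequence in `K` has a weakly
Cauchy subsequence. -/
def IsWeaklyPrecompact {X : Type*} [NormedAddCommGroup X] [NormedSpace ℝ X] (K : Set X) : Prop :=
  ∀ x : ℕ → X, (∀ n, x n ∈ K) → ∃ φ : ℕ → ℕ, StrictMono φ ∧ IsWeaklyCauchySeq (x ∘ φ)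

/-- Property weak (V*): every V*-set is weakly precompact. -/
def HasPropertyWeakVStar (X : Type*) [NormedAddCommGroup X] [NormedSpace ℝ X] : Prop :=
  ∀ K : Set X, IsVStarSet K → IsWeaklyPrecompact K

/-! ### Truncation inequalities in lattice-ordered groups. -/

section LatticeGroup

variable {E : Type*} [AddCommGroup E] [Lattice E] [IsOrderedAddMonoid E]

/-! Weakly Cauchy subsequences are found first in order intervals, then in V*-sets by truncation. A
bounded sequence lies in the ideal generated by a single v ≥ 0. Order continuity of the norm yields
a positive φ controlling the norm on [0, v], so every positive functional is, up to a small error on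
[0, v], dominated by a multiple of φ (`exists_sub_le_of_control`). The map of the ideal into L¹(φ)
is 2-summing, and Pietsch domination gives a semi-inner product B on the ideal with φ(|x|)² ≤ B(x,
x). Functionals dominated by φ are therefore B-continuous, and a subsequence along which all the
numbers B(y_m, y_n) converge in n is weakly Cauchy, as in a Hilbert space.

It remains to see that, for each positive f, a V*-sequence is uniformly f-close to its truncations
at kv (`exists_forall_apply_posPart_sub_le`). Otherwise f stays large on some excesses (x_n - kv)⁺
with k arbitrarily large. Along a sparse sequence of such excesses, the parts of f carried by the
tails decrease, and their successive differences form a weakly unconditionally Cauchy series that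
does not tend to 0 uniformly on the sequence.

For a subspace X, restriction to X preserves weakly unconditionally Cauchy series, and Hahn–Banach
extends the functionals on X to E. -/

theorem sub_inf_le_of_le_add {x y z : E} (hy : 0 ≤ y) (hz : z ≤ x + y) : z - z ⊓ x ≤ y := by
  rw [sub_le_iff_le_add, add_comm y, ← sub_le_iff_le_add]
  exact le_inf (sub_le_self z hy) (sub_le_iff_le_add.2 hz)

theorem add_inf_le_inf_add_inf {x y u : E} (hx : 0 ≤ x) (hy : 0 ≤ y) (hu : 0 ≤ u) :
    (x + y) ⊓ u ≤ x ⊓ u + y ⊓ u := by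
  rw [← sub_le_iff_le_add']
  refine le_inf ?_ ?_
  · rw [sub_le_iff_le_add, ← sub_le_iff_le_add']
    exact le_inf (sub_le_iff_le_add.2 (inf_le_left.trans_eq (add_comm x y) |>.trans_eq
      (add_comm y x))) ((sub_le_self _ hy).trans inf_le_right)
  · exact (sub_le_self _ (le_inf hx hu)).trans inf_le_right

theorem inf_add_inf_le_add_inf_add {x y a b : E} : x ⊓ a + y ⊓ b ≤ (x + y) ⊓ (a + b) :=
  le_inf (add_le_add inf_le_left inf_le_left) (add_le_add inf_le_right inf_le_right)

end LatticeGroup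

/-! ### Positive functionals: positive parts, carriers, norming functionals. -/

section PositiveFunctional

variable {E : Type*} [NormedAddCommGroup E] [NormedSpace ℝ E] [Lattice E]

/-- A continuous linear functional is positive if it is nonnegative on the positive cone. -/
def IsPositiveFunctional (f : StrongDual ℝ E) : Prop := ∀ x, 0 ≤ x → 0 ≤ f x

namespace IsPositiveFunctional

variable [IsOrderedAddMonoid E] {f : StrongDual ℝ E}

theorem mono (hf : IsPositiveFunctional f) {x y : E} (h : x ≤ y) : f x ≤ f y := by
  have := hf _ (sub_nonneg.2 h)
  rwa [map_sub, sub_nonneg] at this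

theorem abs_le (hf : IsPositiveFunctional f) (x : E) : |f x| ≤ f |x| := by
  rw [_root_.abs_le]
  constructor
  · rw [← map_neg]; exact hf.mono (neg_le.1 (neg_le_abs x))
  · exact hf.mono (le_abs_self x)

theorem partialSups_le (hf : IsPositiveFunctional f)
    {y : ℕ → E} (hy : ∀ n, 0 ≤ y n) (n : ℕ) :
    f (partialSups y n) ≤ ∑ i ∈ Finset.range (n + 1), f (y i) := by
  rw [← map_sum]
  exact hf.mono (_root_.partialSups_le _ _ _ fun i hi =>
    Finset.single_le_sum (f := y) (fun i _ => hy i) (Finset.mem_range.2 (by omega)))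

end IsPositiveFunctional

variable [IsOrderedAddMonoid E] [HasSolidNorm E]

omit [NormedSpace ℝ E] in
theorem norm_le_norm_of_nonneg_of_le {x y : E} (hx : 0 ≤ x) (h : x ≤ y) : ‖x‖ ≤ ‖y‖ :=
  norm_le_norm_of_abs_le_abs (by rwa [abs_of_nonneg hx, abs_of_nonneg (hx.trans h)])

/-- A nonnegative, bounded, additive function on the positive cone extends to a continuous linear
functional. -/
theorem exists_strongDual_eq_on_nonneg {h : E → ℝ} {C : ℝ}
    (hadd : ∀ x y, 0 ≤ x → 0 ≤ y → h (x + y) = h x + h y) (h0 : ∀ x, 0 ≤ x → 0 ≤ h x)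
    (hC : ∀ x, 0 ≤ x → h x ≤ C * ‖x‖) :
    ∃ g : StrongDual ℝ E, ∀ x, 0 ≤ x → g x = h x := by
  have key : ∀ a b, 0 ≤ a → 0 ≤ b → h (a - b)⁺ - h (a - b)⁻ = h a - h b := by
    intro a b ha hb
    have e : (a - b)⁺ + b = a + (a - b)⁻ := by
      have := posPart_sub_negPart (a - b)
      rw [sub_eq_sub_iff_add_eq_add] at this
      rw [this]
    have e1 := hadd _ _ (posPart_nonneg (a - b)) hb
    have e2 := hadd _ _ ha (negPart_nonneg (a - b))
    rw [e] at e1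
    linarith
  let G : E →+ ℝ := AddMonoidHom.mk' (fun x => h x⁺ - h x⁻) (by
    intro x y
    have e : x + y = (x⁺ + y⁺) - (x⁻ + y⁻) := by
      conv_lhs => rw [← posPart_sub_negPart x, ← posPart_sub_negPart y]
      abel
    have := key (x⁺ + y⁺) (x⁻ + y⁻) (by positivity) (by positivity)
    rw [← e, hadd _ _ (posPart_nonneg x) (posPart_nonneg y),
      hadd _ _ (negPart_nonneg x) (negPart_nonneg y)] at this
    rw [this]; ring)
  have hG : ∀ x, G x = h x⁺ - h x⁻ := fun _ => rfl
  have hGb : ∀ x, ‖G x‖ ≤ C * ‖x‖ := by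
    intro x
    have e1 := h0 _ (posPart_nonneg x)
    have e2 := h0 _ (negPart_nonneg x)
    have e3 := hC _ (abs_nonneg x)
    rw [norm_abs_eq_norm, ← posPart_add_negPart, hadd _ _ (posPart_nonneg x) (negPart_nonneg x)]
      at e3
    rw [hG, Real.norm_eq_abs, _root_.abs_le]
    constructor <;> linarith
  refine ⟨G.toRealLinearMap (AddMonoidHomClass.continuous_of_bound G C hGb), fun x hx => ?_⟩
  have z : h 0 = 0 := by have := hadd 0 0 le_rfl le_rfl; simpa using this
  change h x⁺ - h x⁻ = h x
  rw [posPart_of_nonneg hx, negPart_of_nonneg hx, z, sub_zero]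

/-- The positive part of a functional (Riesz–Kantorovich). -/
theorem exists_isLUB_image_Icc (f : StrongDual ℝ E) :
    ∃ g : StrongDual ℝ E, ∀ x, 0 ≤ x → IsLUB (f '' Set.Icc 0 x) (g x) := by
  have hle : ∀ x, 0 ≤ x → ∀ r ∈ f '' Set.Icc 0 x, r ≤ ‖f‖ * ‖x‖ := by
    rintro x hx _ ⟨y, ⟨hy0, hyx⟩, rfl⟩
    exact (le_abs_self _).trans ((f.le_opNorm y).trans
      (mul_le_mul_of_nonneg_left (norm_le_norm_of_nonneg_of_le hy0 hyx) (norm_nonneg f)))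
  have hbdd : ∀ x, 0 ≤ x → BddAbove (f '' Set.Icc 0 x) := fun x hx => ⟨_, hle x hx⟩
  have hne : ∀ x : E, 0 ≤ x → (f '' Set.Icc 0 x).Nonempty := fun x hx =>
    ⟨f 0, 0, ⟨le_rfl, hx⟩, rfl⟩
  have hlub : ∀ x, 0 ≤ x → IsLUB (f '' Set.Icc 0 x) (sSup (f '' Set.Icc 0 x)) := fun x hx =>
    isLUB_csSup (hne x hx) (hbdd x hx)
  obtain ⟨g, hg⟩ := exists_strongDual_eq_on_nonneg (h := fun x => sSup (f '' Set.Icc 0 x))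
    (C := ‖f‖) (by
      intro x y hx hy
      refine (hlub _ (add_nonneg hx hy)).unique ?_
      constructor
      · rintro _ ⟨z, ⟨hz0, hz⟩, rfl⟩
        have : f z = f (z ⊓ x) + f (z - z ⊓ x) := by rw [← map_add]; congr 1; abel
        rw [this]
        exact add_le_add ((hlub x hx).1 ⟨_, ⟨le_inf hz0 hx, inf_le_right⟩, rfl⟩)
          ((hlub y hy).1 ⟨_, ⟨sub_nonneg.2 inf_le_left, sub_inf_le_of_le_add hy hz⟩, rfl⟩)
      · intro c hc
        rw [← le_sub_iff_add_le]
        refine (hlub x hx).2 ?_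
        rintro _ ⟨a, ⟨ha0, ha⟩, rfl⟩
        rw [le_sub_comm]
        refine (hlub y hy).2 ?_
        rintro _ ⟨b, ⟨hb0, hb⟩, rfl⟩
        rw [le_sub_iff_add_le', ← map_add]
        exact hc ⟨_, ⟨add_nonneg ha0 hb0, add_le_add ha hb⟩, rfl⟩)
    (fun x hx => (hlub x hx).1 ⟨0, ⟨le_rfl, hx⟩, map_zero f⟩)
    (fun x hx => (hlub x hx).2 (hle x hx))
  exact ⟨g, fun x hx => (hg x hx).symm ▸ hlub x hx⟩

theorem exists_posPart_functional (f : StrongDual ℝ E) :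
    ∃ g : StrongDual ℝ E, IsPositiveFunctional g ∧ (∀ x, 0 ≤ x → f x ≤ g x) ∧
      ∀ x c, 0 ≤ x → (∀ y, 0 ≤ y → y ≤ x → f y ≤ c) → g x ≤ c := by
  obtain ⟨g, hg⟩ := exists_isLUB_image_Icc f
  refine ⟨g, fun x hx => (hg x hx).1 ⟨0, ⟨le_rfl, hx⟩, map_zero f⟩,
    fun x hx => (hg x hx).1 ⟨x, ⟨hx, le_rfl⟩, rfl⟩, fun x c hx h => (hg x hx).2 ?_⟩
  rintro _ ⟨y, ⟨hy0, hy⟩, rfl⟩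
  exact h y hy0 hy

/-- Here g is the part of f carried by the ideal generated by the a m. The doubling hypothesis gives
superadditivity: x ⊓ a m + y ⊓ a n lies below (x + y) ⊓ a k for some k. -/
theorem IsPositiveFunctional.exists_carrier {f : StrongDual ℝ E} (hf : IsPositiveFunctional f)
    {a : ℕ → E} (ha : Monotone a) (ha0 : ∀ m, 0 ≤ a m) (hdouble : ∀ m, ∃ n, a m + a m ≤ a n) :
    ∃ g : StrongDual ℝ E, ∀ x, 0 ≤ x → IsLUB (Set.range fun m => f (x ⊓ a m)) (g x) := by
  have hle : ∀ x, ∀ r ∈ Set.range fun m => f (x ⊓ a m), r ≤ f x := by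
    rintro x _ ⟨m, rfl⟩
    exact hf.mono inf_le_left
  have hlub : ∀ x, IsLUB (Set.range fun m => f (x ⊓ a m)) (⨆ m, f (x ⊓ a m)) := fun x =>
    isLUB_ciSup ⟨_, hle x⟩
  obtain ⟨g, hg⟩ := exists_strongDual_eq_on_nonneg (h := fun x => ⨆ m, f (x ⊓ a m))
    (C := ‖f‖) (by
      intro x y hx hy
      refine (hlub _).unique ?_
      constructor
      · rintro _ ⟨m, rfl⟩
        refine (hf.mono (add_inf_le_inf_add_inf hx hy (ha0 m))).trans ?_
        rw [map_add]
        exact add_le_add ((hlub x).1 ⟨m, rfl⟩) ((hlub y).1 ⟨m, rfl⟩)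
      · intro c hc
        rw [← le_sub_iff_add_le]
        refine (hlub x).2 ?_
        rintro _ ⟨m, rfl⟩
        rw [le_sub_comm]
        refine (hlub y).2 ?_
        rintro _ ⟨n, rfl⟩
        dsimp only
        rw [le_sub_iff_add_le', ← map_add]
        obtain ⟨k, hk⟩ := hdouble (max m n)
        refine (hf.mono ?_).trans (hc ⟨k, rfl⟩)
        refine inf_add_inf_le_add_inf_add.trans (inf_le_inf_left _ (le_trans ?_ hk))
        exact add_le_add (ha (le_max_left m n)) (ha (le_max_right m n)))
    (fun x hx => (hf _ (le_inf hx (ha0 0))).trans ((hlub x).1 ⟨0, rfl⟩))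
    (fun x hx => (hlub x).2 (by
      rintro _ ⟨m, rfl⟩
      exact (hf.mono inf_le_left).trans ((le_abs_self _).trans (f.le_opNorm x))))
  exact ⟨g, fun x hx => (hg x hx).symm ▸ hlub x⟩

theorem exists_positive_norming {x : E} (hx : 0 ≤ x) :
    ∃ f : StrongDual ℝ E, IsPositiveFunctional f ∧ f x = ‖x‖ ∧ ∀ y, 0 ≤ y → f y ≤ ‖y‖ := by
  obtain ⟨g, hg1, hgx⟩ := exists_dual_vector'' ℝ x
  obtain ⟨f, hf, hgf, hfu⟩ := exists_posPart_functional g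
  have hb : ∀ y, 0 ≤ y → f y ≤ ‖y‖ := fun y hy => hfu y _ hy fun z hz0 hz =>
    (le_abs_self _).trans ((g.le_of_opNorm_le hg1 z).trans (by
      rw [one_mul]; exact norm_le_norm_of_nonneg_of_le hz0 hz))
  exact ⟨f, hf, le_antisymm (hb x hx) (hgx.symm.le.trans (hgf x hx)), hb⟩

end PositiveFunctional

/-! ### Order continuity and control functionals. -/

section OrderContinuous

variable {E : Type*} [NormedAddCommGroup E] [NormedSpace ℝ E] [CompleteSpace E]
  [Lattice E] [IsOrderedAddMonoid E] [IsOrderedModule ℝ E] [HasSolidNorm E]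

omit [CompleteSpace E] in
/-- A bounded increasing sequence in a normed lattice with order continuous norm is Cauchy. -/
theorem HasOrderContinuousNorm.cauchySeq_of_monotone (hE : HasOrderContinuousNorm E)
    {u : ℕ → E} (hu : Monotone u) {v : E} (huv : ∀ n, u n ≤ v) : CauchySeq u := by
  -- The gaps between upper bounds and terms form a downward directed set with infimum 0; a gap of
  -- small norm bounds the whole tail of u.
  have hG := hE {z | ∃ b n, (∀ m, u m ≤ b) ∧ z = b - u n} ⟨_, v, 0, huv, rfl⟩ ?_ ?_
  · rw [Metric.cauchySeq_iff']
    intro ε hε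
    obtain ⟨_, ⟨_, ⟨b, n, hb, rfl⟩, rfl⟩, hlt⟩ : ∃ r ∈ (fun a => ‖a‖) '' {z | ∃ b n,
        (∀ m, u m ≤ b) ∧ z = b - u n}, r < ε := by
      by_contra! hcon
      exact absurd (hG.2 fun r hr => hcon r hr) (not_le.2 hε)
    refine ⟨n, fun m hm => ?_⟩
    rw [dist_eq_norm]
    exact (norm_le_norm_of_nonneg_of_le (sub_nonneg.2 (hu hm))
      (sub_le_sub_right (hb m) _)).trans_lt hlt
  · rintro _ ⟨b, n, hb, rfl⟩ _ ⟨b', n', hb', rfl⟩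
    refine ⟨_, ⟨b ⊓ b', max n n', fun m => le_inf (hb m) (hb' m), rfl⟩, ?_, ?_⟩
    · exact sub_le_sub inf_le_left (hu (le_max_left n n'))
    · exact sub_le_sub inf_le_right (hu (le_max_right n n'))
  · refine ⟨?_, fun z hz => ?_⟩
    · rintro _ ⟨b, n, hb, rfl⟩
      exact sub_nonneg.2 (hb n)
    -- If z lies below every gap, subtracting z from an upper bound leaves an upper bound. Iterating
    -- gives k • z ≤ v - u 0 for all k, hence z ≤ 0.
    · have key : ∀ k : ℕ, ∀ m, u m ≤ v - k • z := by
        intro k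
        induction k with
        | zero => simpa using huv
        | succ k ih =>
          intro m
          have := hz ⟨_, m, ih, rfl⟩
          rw [succ_nsmul]
          rw [le_sub_comm] at this
          rwa [← sub_sub]
      have h1 : ∀ k : ℕ, z ≤ (1 / ((k : ℝ) + 1)) • (v - u 0) := by
        intro k
        have h2 : (k + 1) • z ≤ v - u 0 := le_sub_comm.1 (key (k + 1) 0)
        have h3 := smul_le_smul_of_nonneg_left h2 (by positivity : (0 : ℝ) ≤ 1 / ((k : ℝ) + 1))
        rw [← Nat.cast_smul_eq_nsmul ℝ, smul_smul] at h3
        push_cast at h3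
        rwa [one_div_mul_cancel (by positivity), one_smul] at h3
      have ht : Tendsto (fun k : ℕ => (1 / ((k : ℝ) + 1)) • (v - u 0)) atTop (𝓝 0) := by
        simpa using (tendsto_one_div_add_atTop_nhds_zero_nat (𝕜 := ℝ)).smul_const (v - u 0)
      exact ge_of_tendsto' ht h1

omit [CompleteSpace E] in
theorem HasOrderContinuousNorm.cauchySeq_of_antitone (hE : HasOrderContinuousNorm E)
    {u : ℕ → E} (hu : Antitone u) {v : E} (huv : ∀ n, v ≤ u n) : CauchySeq u := by
  have := hE.cauchySeq_of_monotone (u := fun n => -u n) (fun m n h => neg_le_neg (hu h))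
    (fun n => neg_le_neg (huv n))
  simpa [Function.comp_def] using (uniformContinuous_neg (α := E)).comp_cauchySeq this

/-- Otherwise there are y n in [0, v] of norm > ε on which the norming functionals of all earlier
terms are below 2⁻ⁿ. The tail suprema w j decrease in norm to some z on which every norming
functional is ≤ 0. Yet the one for y j exceeds ε at w j, which contradicts w j → z. -/
theorem HasOrderContinuousNorm.exists_functional_norm_le (hE : HasOrderContinuousNorm E)
    (v : E) {ε : ℝ} (hε : 0 < ε) :
    ∃ f : StrongDual ℝ E, IsPositiveFunctional f ∧ ∃ δ > 0, ∀ y, 0 ≤ y → y ≤ v →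
      f y < δ → ‖y‖ ≤ ε := by
  by_contra! hcon
  choose! Y hY0 hYv hYf hYn using hcon
  choose! N hNpos hNeq hNle using fun (x : E) (hx : 0 ≤ x) => exists_positive_norming hx
  -- `F n` is the sum of the norming functionals chosen so far
  let F : ℕ → StrongDual ℝ E := fun n =>
    Nat.rec 0 (fun k g => g + N (Y g ((1 / 2) ^ k))) n
  let y : ℕ → E := fun n => Y (F n) ((1 / 2) ^ n)
  have hFs : ∀ n, F (n + 1) = F n + N (y n) := fun n => rfl
  have hp : ∀ n : ℕ, (0 : ℝ) < (1 / 2) ^ n := fun n => by positivity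
  have hF : ∀ n, IsPositiveFunctional (F n) := by
    intro n
    induction n with
    | zero => intro x hx; exact le_rfl
    | succ n ih =>
      rw [hFs]
      intro x hx
      exact add_nonneg (ih x hx) (hNpos _ (hY0 _ ih _ (hp n)) x hx)
  have hy0 : ∀ n, 0 ≤ y n := fun n => hY0 _ (hF n) _ (hp n)
  have hyv : ∀ n, y n ≤ v := fun n => hYv _ (hF n) _ (hp n)
  have hyf : ∀ n, F n (y n) < (1 / 2) ^ n := fun n => hYf _ (hF n) _ (hp n)
  have hyn : ∀ n, ε < ‖y n‖ := fun n => hYn _ (hF n) _ (hp n)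
  have hNF : ∀ i n, i < n → ∀ x, 0 ≤ x → N (y i) x ≤ F n x := by
    intro i n hin x hx
    induction n, hin using Nat.le_induction with
    | base => rw [hFs]; exact le_add_of_nonneg_left (hF i x hx)
    | succ n hn ih =>
      rw [hFs]; exact ih.trans (le_add_of_nonneg_right (hNpos _ (hy0 n) x hx))
  have hNy : ∀ i n, i < n → N (y i) (y n) ≤ (1 / 2) ^ n := fun i n h =>
    (hNF i n h _ (hy0 n)).trans (hyf n).le
  have hlim : ∀ j, ∃ w, Tendsto (fun n => partialSups (fun i => y (j + i)) n) atTop (𝓝 w) :=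
    fun j => cauchySeq_tendsto_of_complete (hE.cauchySeq_of_monotone
      (partialSups (fun i => y (j + i))).monotone
      (fun n => _root_.partialSups_le _ _ _ fun i _ => hyv _))
  choose w hw using hlim
  have hwy : ∀ j, y j ≤ w j := fun j => ge_of_tendsto' (hw j) fun n =>
    le_partialSups_of_le (fun i => y (j + i)) (Nat.zero_le n)
  have hwanti : Antitone w := antitone_nat_of_succ_le fun j =>
    le_of_tendsto_of_tendsto (hw (j + 1)) ((hw j).comp (tendsto_add_atTop_nat 1))
      (Eventually.of_forall fun n => _root_.partialSups_le _ _ _ fun i hi => by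
        have := le_partialSups_of_le (fun i => y (j + i)) (Nat.succ_le_succ hi)
        simpa [add_assoc, add_comm 1 i] using this)
  have hNw : ∀ i j, i < j → N (y i) (w j) ≤ 2 * (1 / 2) ^ j := by
    intro i j hij
    refine le_of_tendsto' (((N (y i)).continuous.tendsto _).comp (hw j)) fun n => ?_
    refine ((hNpos _ (hy0 i)).partialSups_le (fun _ => hy0 _) n).trans ?_
    calc ∑ k ∈ Finset.range (n + 1), N (y i) (y (j + k))
        ≤ ∑ k ∈ Finset.range (n + 1), (1 / 2 : ℝ) ^ j * (1 / 2) ^ k :=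
          Finset.sum_le_sum fun k _ => (hNy i (j + k) (by omega)).trans_eq (pow_add _ _ _)
      _ = (1 / 2 : ℝ) ^ j * ∑ k ∈ Finset.range (n + 1), (1 / 2 : ℝ) ^ k := by
          rw [Finset.mul_sum]
      _ ≤ (1 / 2 : ℝ) ^ j * 2 := by
          gcongr
          exact sum_geometric_two_le (n + 1)
      _ = 2 * (1 / 2) ^ j := mul_comm _ _
  obtain ⟨z, hz⟩ := cauchySeq_tendsto_of_complete (hE.cauchySeq_of_antitone hwanti
    fun n => (hy0 n).trans (hwy n))
  have hzw : ∀ j, z ≤ w j := fun j => hwanti.le_of_tendsto hz j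
  have hNz : ∀ i, N (y i) z ≤ 0 := by
    intro i
    have h2 : Tendsto (fun j : ℕ => 2 * (1 / 2 : ℝ) ^ j) atTop (𝓝 0) := by
      simpa using (tendsto_pow_atTop_nhds_zero_of_lt_one (by norm_num : (0 : ℝ) ≤ 1 / 2)
        (by norm_num)).const_mul 2
    refine ge_of_tendsto h2 ((eventually_gt_atTop i).mono fun j hj => ?_)
    exact ((hNpos _ (hy0 i)).mono (hzw j)).trans (hNw i j hj)
  have hdiff : Tendsto (fun j => ‖w j - z‖) atTop (𝓝 0) := tendsto_iff_norm_sub_tendsto_zero.1 hz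
  obtain ⟨j, hj⟩ := (hdiff.eventually (gt_mem_nhds hε)).exists
  have h1 := hNle _ (hy0 j) (w j - z) (sub_nonneg.2 (hzw j))
  have h2 := (hNpos _ (hy0 j)).mono (hwy j)
  rw [hNeq _ (hy0 j)] at h2
  rw [map_sub] at h1
  linarith [hNz j, hyn j]

/-- A control functional for an order interval: it dominates the norm in the `ε`-`δ` sense. -/
theorem HasOrderContinuousNorm.exists_control_functional (hE : HasOrderContinuousNorm E) (v : E) :
    ∃ φ : StrongDual ℝ E, IsPositiveFunctional φ ∧ ∀ ε > 0, ∃ δ > 0, ∀ y, 0 ≤ y → y ≤ v →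
      φ y < δ → ‖y‖ ≤ ε := by
  choose f hf δ hδ hfδ using fun n : ℕ =>
    hE.exists_functional_norm_le v (ε := 1 / ((n : ℝ) + 1)) (by positivity)
  obtain ⟨g, hgdef⟩ : ∃ g : ℕ → StrongDual ℝ E,
      ∀ n, g n = ((1 / 2) ^ n / (1 + ‖f n‖) : ℝ) • f n := ⟨_, fun _ => rfl⟩
  have hga : ∀ n x, g n x = ((1 / 2) ^ n / (1 + ‖f n‖) : ℝ) * f n x := fun n x => by
    rw [hgdef]; rfl
  have hc : ∀ n, (0 : ℝ) < (1 / 2) ^ n / (1 + ‖f n‖) := fun n => by positivity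
  have hg : ∀ n, IsPositiveFunctional (g n) := fun n x hx => by
    rw [hga]; exact mul_nonneg (hc n).le (hf n x hx)
  have hsum : Summable g := by
    refine Summable.of_norm_bounded summable_geometric_two fun n => ?_
    rw [hgdef, norm_smul, Real.norm_of_nonneg (hc n).le, div_mul_eq_mul_div, div_le_iff₀ (by positivity)]
    gcongr
    linarith
  have hap : ∀ x, HasSum (fun n => g n x) ((∑' n, g n) x) := fun x =>
    ((ContinuousLinearMap.apply ℝ ℝ x).hasSum hsum.hasSum)
  have hle : ∀ n x, 0 ≤ x → g n x ≤ (∑' n, g n) x := fun n x hx =>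
    le_hasSum (hap x) n fun m _ => hg m x hx
  refine ⟨∑' n, g n, fun x hx => (hap x).nonneg fun n => hg n x hx, fun ε hε => ?_⟩
  obtain ⟨n, hn⟩ := exists_nat_one_div_lt hε
  refine ⟨(1 / 2) ^ n / (1 + ‖f n‖) * δ n, mul_pos (hc n) (hδ n), fun y hy0 hyv hy => ?_⟩
  refine (hfδ n y hy0 hyv ?_).trans hn.le
  have := (hle n y hy0).trans_lt hy
  rw [hga] at this
  exact lt_of_mul_lt_mul_left this (hc n).le

end OrderContinuous

/-! ### States on a principal ideal and the summing inequality. -/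

section PrincipalIdeal

variable {E : Type*} [NormedAddCommGroup E] [NormedSpace ℝ E]
  [Lattice E] [IsOrderedAddMonoid E] [IsOrderedModule ℝ E]

/-- The order ideal generated by an element `v`. -/
def principalIdeal (v : E) : Submodule ℝ E where
  carrier := {x | ∃ c : ℝ, 0 ≤ c ∧ |x| ≤ c • v}
  zero_mem' := ⟨0, le_rfl, by simp⟩
  add_mem' := by
    rintro x y ⟨c, hc, hx⟩ ⟨d, hd, hy⟩
    exact ⟨c + d, add_nonneg hc hd, (abs_add_le x y).trans (by
      rw [add_smul]; exact add_le_add hx hy)⟩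
  smul_mem' := by
    rintro a x ⟨c, hc, hx⟩
    refine ⟨|a| * c, by positivity, ?_⟩
    rw [mul_smul]
    refine le_trans ?_ (smul_le_smul_of_nonneg_left hx (abs_nonneg a))
    refine abs_le'.2 ⟨?_, ?_⟩
    · rcases le_total 0 a with h | h
      · rw [_root_.abs_of_nonneg h]; exact smul_le_smul_of_nonneg_left (le_abs_self x) h
      · rw [_root_.abs_of_nonpos h, ← neg_smul_neg]
        exact smul_le_smul_of_nonneg_left (neg_le_abs x) (neg_nonneg.2 h)
    · rcases le_total 0 a with h | h
      · rw [_root_.abs_of_nonneg h, ← smul_neg]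
        exact smul_le_smul_of_nonneg_left (neg_le_abs x) h
      · rw [_root_.abs_of_nonpos h, ← neg_smul]
        exact smul_le_smul_of_nonneg_left (le_abs_self x) (neg_nonneg.2 h)

/-- The positive functionals normalized at `v`. -/
def normalizedStates (v : E) : Set (StrongDual ℝ E) := {t | IsPositiveFunctional t ∧ t v = 1}

omit [IsOrderedModule ℝ E] in
theorem abs_apply_le_of_mem_normalizedStates {v x : E} {c : ℝ} (hx : |x| ≤ c • v)
    {t : StrongDual ℝ E} (ht : t ∈ normalizedStates v) : |t x| ≤ c := by
  have := (ht.1.abs_le x).trans (ht.1.mono hx)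
  rwa [map_smul, ht.2, smul_eq_mul, mul_one] at this

theorem abs_smul_of_nonneg {c : ℝ} (hc : 0 ≤ c) (x : E) : |c • x| = c • |x| := by
  refine le_antisymm (abs_le'.2 ⟨?_, ?_⟩) ?_
  · exact smul_le_smul_of_nonneg_left (le_abs_self x) hc
  · rw [← smul_neg]; exact smul_le_smul_of_nonneg_left (neg_le_abs x) hc
  · rcases hc.eq_or_lt with rfl | hpos
    · simp
    · rw [← le_inv_smul_iff_of_pos hpos]
      refine abs_le'.2 ⟨?_, ?_⟩
      · rw [le_inv_smul_iff_of_pos hpos]; exact le_abs_self _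
      · rw [le_inv_smul_iff_of_pos hpos, smul_neg]; exact neg_le_abs _

variable [HasSolidNorm E]

theorem exists_positive_functional_neg {z : E} (hz : ¬ 0 ≤ z) :
    ∃ f : StrongDual ℝ E, IsPositiveFunctional f ∧ f z < 0 := by
  have hconv : Convex ℝ {x : E | 0 ≤ x} := convex_Ici 0
  obtain ⟨f, s, hfs, hf⟩ := geometric_hahn_banach_point_closed hconv isClosed_nonneg hz
  have hs : s < 0 := by simpa using hf 0 le_rfl
  refine ⟨f, fun x hx => ?_, hfs.trans hs⟩
  by_contra! hneg
  have := hf ((s / f x) • x) (smul_nonneg (div_pos_of_neg_of_neg hs hneg).le hx)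
  rw [map_smul, smul_eq_mul, div_mul_cancel₀ _ hneg.ne] at this
  exact lt_irrefl _ this

theorem le_smul_of_forall_mem_normalizedStates {v u : E} (hv : 0 ≤ v)
    (hu : u ∈ principalIdeal v) {r : ℝ} (h : ∀ t ∈ normalizedStates v, t u ≤ r) :
    u ≤ r • v := by
  by_contra hcon
  obtain ⟨f, hf, hneg⟩ := exists_positive_functional_neg (z := r • v - u) (by rwa [sub_nonneg])
  obtain ⟨c, hc, huc⟩ := hu
  rw [map_sub, map_smul, smul_eq_mul] at hneg
  have h1 : f u ≤ c * f v := by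
    have := hf.mono ((le_abs_self u).trans huc)
    rwa [map_smul, smul_eq_mul] at this
  rcases (hf v hv).eq_or_lt with h0 | hpos
  · rw [← h0] at h1 hneg; linarith
  · have := h ((f v)⁻¹ • f) ⟨fun x hx => mul_nonneg (inv_nonneg.2 hpos.le) (hf x hx),
      inv_mul_cancel₀ hpos.ne'⟩
    have e : ((f v)⁻¹ • f) u = (f v)⁻¹ * f u := rfl
    rw [e, inv_mul_le_iff₀ hpos] at this
    linarith

/-- Since |z| is the supremum of z and -z, the bound reduces to all signed sums u ± z₁ ± z₂ ⋯, and
states detect the order on the ideal. This stands in for representing the ideal as functions: only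
|t z|, not the larger t |z|, is needed. -/
theorem add_sum_abs_le_smul {v : E} (hv : 0 ≤ v) {r : ℝ} (l : List (principalIdeal v))
    (u : principalIdeal v)
    (h : ∀ t ∈ normalizedStates v, t u + (l.map fun z : principalIdeal v => |t z|).sum ≤ r) :
    (u : E) + (l.map fun z : principalIdeal v => |(z : E)|).sum ≤ r • v := by
  induction l generalizing u with
  | nil =>
    simpa using le_smul_of_forall_mem_normalizedStates hv u.2 (by simpa using h)
  | cons z l ih =>
    have h1 := ih (u + z) fun t ht => by
      refine le_trans ?_ (h t ht)
      simp only [List.map_cons, List.sum_cons, Submodule.coe_add, map_add]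
      linarith [le_abs_self (t z)]
    have h2 := ih (u - z) fun t ht => by
      refine le_trans ?_ (h t ht)
      simp only [List.map_cons, List.sum_cons, Submodule.coe_sub, map_sub]
      linarith [neg_le_abs (t z)]
    simp only [Submodule.coe_add, Submodule.coe_sub] at h1 h2
    simp only [List.map_cons, List.sum_cons]
    have h3 : |(z : E)| ≤ r • v - u - (l.map fun z : principalIdeal v => |(z : E)|).sum := by
      refine abs_le'.2 ⟨?_, ?_⟩
      · rw [le_sub_iff_add_le, le_sub_iff_add_le]
        refine le_of_eq_of_le ?_ h1
        abel
      · rw [le_sub_iff_add_le, le_sub_iff_add_le]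
        refine le_of_eq_of_le ?_ h2
        abel
    calc (u : E) + (|(z : E)| + (l.map fun z : principalIdeal v => |(z : E)|).sum)
        ≤ u + ((r • v - u - (l.map fun z : principalIdeal v => |(z : E)|).sum) +
          (l.map fun z : principalIdeal v => |(z : E)|).sum) := by gcongr
      _ = r • v := by abel

theorem IsPositiveFunctional.not_forall_sum_sq_sub_le {φ : StrongDual ℝ E}
    (hφ : IsPositiveFunctional φ) {v : E} (hv : 0 ≤ v) (hT : (normalizedStates v).Nonempty)
    (l : List (principalIdeal v)) {δ : ℝ} (hδ : 0 < δ) : ¬ ∀ t ∈ normalizedStates v,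
      (l.map fun x : principalIdeal v => φ v ^ 2 * (t x) ^ 2 - φ |(x : E)| ^ 2).sum ≤ -δ := by
  intro h
  rcases (hφ v hv).eq_or_lt with h0 | hφv
  · obtain ⟨t, ht⟩ := hT
    have hzero : ∀ x : principalIdeal v, φ |(x : E)| = 0 := by
      rintro ⟨x, c, -, hx⟩
      refine le_antisymm ?_ (hφ _ (abs_nonneg _))
      refine (hφ.mono hx).trans_eq ?_
      rw [map_smul, ← h0, smul_zero]
    have := h t ht
    simp [hzero, ← h0] at this
    linarith
  · let b : principalIdeal v → principalIdeal v := fun x => (φ v * φ |(x : E)|) • x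
    have hb : ∀ x, 0 ≤ φ v * φ |(x : E)| := fun x => mul_nonneg hφv.le (hφ _ (abs_nonneg _))
    set A := (l.map fun x : principalIdeal v => φ |(x : E)| ^ 2).sum with hA
    -- By the arithmetic-geometric mean inequality, φ(v) φ(|x|) |t x| is at most half of φ(v)² (t
    -- x)² + φ(|x|)². Applying φ to the resulting bound gives φ(v) A ≤ (A - δ/2) φ(v), which is
    -- absurd.
    have key := add_sum_abs_le_smul hv (r := A - δ / 2) (l.map b) 0 fun t ht => by
      have h1 := h t ht
      have h2 : ((l.map b).map fun z : principalIdeal v => |t z|).sum ≤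
          (l.map fun x : principalIdeal v =>
            (1 / 2) * (φ v ^ 2 * (t x) ^ 2 - φ |(x : E)| ^ 2) + φ |(x : E)| ^ 2).sum := by
        rw [List.map_map]
        refine List.sum_le_sum fun x _ => ?_
        simp only [Function.comp, b, Submodule.coe_smul, map_smul, smul_eq_mul, abs_mul]
        rw [abs_of_pos hφv, _root_.abs_of_nonneg (hφ _ (abs_nonneg (x : E)))]
        nlinarith [sq_nonneg (φ v * |t x| - φ |(x : E)|), sq_abs (t x)]
      rw [List.sum_map_add, List.sum_map_mul_left] at h2
      simp only [Submodule.coe_zero, map_zero]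
      linarith
    have h3 := hφ.mono key
    have h4 : φ ((l.map b).map fun z : principalIdeal v => |(z : E)|).sum = φ v * A := by
      rw [map_list_sum, List.map_map, List.map_map, hA, ← List.sum_map_mul_left]
      congr 1
      refine List.map_congr_left fun x _ => ?_
      simp only [Function.comp, b, Submodule.coe_smul]
      rw [abs_smul_of_nonneg (hb x), map_smul, smul_eq_mul]
      ring
    rw [Submodule.coe_zero, zero_add, h4, map_smul, smul_eq_mul] at h3
    nlinarith

end PrincipalIdeal

/-! ### Pietsch domination and the semi-inner product. -/

section Bilinear

variable {E : Type*} [NormedAddCommGroup E] [NormedSpace ℝ E]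
  [Lattice E] [IsOrderedAddMonoid E] [IsOrderedModule ℝ E]

/-- The evaluation map from the ideal generated by `v` into the bounded functions on the states. -/
noncomputable def stateEval (v : E) :
    principalIdeal v →ₗ[ℝ] BoundedContinuousFunction (normalizedStates v) ℝ where
  toFun x := BoundedContinuousFunction.ofNormedAddCommGroup (fun t => t.1 x)
    (by fun_prop) x.2.choose fun t =>
      abs_apply_le_of_mem_normalizedStates x.2.choose_spec.2 t.2
  map_add' x y := by ext t; simp
  map_smul' c x := by ext t; simp

@[simp]
theorem stateEval_apply (v : E) (x : principalIdeal v) (t : normalizedStates v) :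
    stateEval v x t = t.1 x := rfl

theorem norm_stateEval_le {v : E} {x : principalIdeal v} {c : ℝ} (hc : 0 ≤ c)
    (hx : |(x : E)| ≤ c • v) : ‖stateEval v x‖ ≤ c :=
  (BoundedContinuousFunction.norm_le hc).2 fun t =>
    abs_apply_le_of_mem_normalizedStates hx t.2

/-- The cone generated by the functions `φ(v)² x̂² - φ(|x|)²`. -/
def summingCone (φ : StrongDual ℝ E) (v : E) :
    Set (BoundedContinuousFunction (normalizedStates v) ℝ) :=
  {F | ∃ l : List (principalIdeal v), ∀ t, F t =
    (l.map fun x : principalIdeal v => φ v ^ 2 * (t.1 x) ^ 2 - φ |(x : E)| ^ 2).sum}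

theorem smul_mem_summingCone {φ : StrongDual ℝ E} {v : E} {c : ℝ} (hc : 0 ≤ c)
    {F : BoundedContinuousFunction (normalizedStates v) ℝ} (hF : F ∈ summingCone φ v) :
    c • F ∈ summingCone φ v := by
  obtain ⟨l, hl⟩ := hF
  refine ⟨l.map fun x => √c • x, fun t => ?_⟩
  change c * F t = _
  rw [hl, List.map_map, ← List.sum_map_mul_left]
  congr 1
  refine List.map_congr_left fun x _ => ?_
  simp only [Function.comp, Submodule.coe_smul]
  rw [abs_smul_of_nonneg (Real.sqrt_nonneg c), map_smul, map_smul, smul_eq_mul, smul_eq_mul,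
    mul_pow, mul_pow, Real.sq_sqrt hc]
  ring

theorem convex_summingCone (φ : StrongDual ℝ E) (v : E) : Convex ℝ (summingCone φ v) := by
  intro F hF G hG a b ha hb _
  obtain ⟨l, hl⟩ := smul_mem_summingCone ha hF
  obtain ⟨m, hm⟩ := smul_mem_summingCone hb hG
  refine ⟨l ++ m, fun t => ?_⟩
  rw [List.map_append, List.sum_append, ← hl, ← hm]
  rfl

variable [HasSolidNorm E]

/-- Pietsch's domination theorem for the inclusion of an order ideal into the `L¹`-seminorm given
by a positive functional. -/
theorem IsPositiveFunctional.exists_pietsch {φ : StrongDual ℝ E} (hφ : IsPositiveFunctional φ)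
    {v : E} (hv : 0 ≤ v) (hT : (normalizedStates v).Nonempty) :
    ∃ m : StrongDual ℝ (BoundedContinuousFunction (normalizedStates v) ℝ),
      ∀ x : principalIdeal v, φ |(x : E)| ^ 2 ≤ m (stateEval v x * stateEval v x) := by
  let N : Set (BoundedContinuousFunction (normalizedStates v) ℝ) := {F | ∃ δ > 0, ∀ t, F t ≤ -δ}
  have hN : Convex ℝ N := by
    rintro F ⟨δ, hδ, hF⟩ G ⟨δ', hδ', hG⟩ a b ha hb hab
    refine ⟨min δ δ', lt_min hδ hδ', fun t => ?_⟩
    have h1 := mul_le_mul_of_nonneg_left ((hF t).trans (neg_le_neg (min_le_left δ δ'))) ha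
    have h2 := mul_le_mul_of_nonneg_left ((hG t).trans (neg_le_neg (min_le_right δ δ'))) hb
    calc (a • F + b • G) t = a * F t + b * G t := rfl
      _ ≤ a * -min δ δ' + b * -min δ δ' := add_le_add h1 h2
      _ = -min δ δ' := by rw [← add_mul, hab, one_mul]
  have hNo : IsOpen N := by
    rw [Metric.isOpen_iff]
    rintro F ⟨δ, hδ, hF⟩
    refine ⟨δ / 2, by positivity, fun G hG => ⟨δ / 2, by positivity, fun t => ?_⟩⟩
    have h1 := (BoundedContinuousFunction.dist_coe_le_dist (f := G) (g := F) t).trans_lt hG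
    rw [Real.dist_eq] at h1
    linarith [hF t, le_abs_self (G t - F t)]
  have hdisj : Disjoint N (summingCone φ v) := by
    rw [Set.disjoint_left]
    rintro F ⟨δ, hδ, hF⟩ ⟨l, hl⟩
    exact hφ.not_forall_sum_sq_sub_le hv hT l hδ fun t ht => (hl ⟨t, ht⟩) ▸ hF ⟨t, ht⟩
  -- The separating functional is nonnegative on the cone by scaling, and positive at 1 since -1
  -- lies in `N` and 0 in the cone; it is then rescaled by φ(v)² / m 1.
  obtain ⟨m, u, hm1, hm2⟩ := geometric_hahn_banach_open hN hNo (convex_summingCone φ v) hdisj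
  have hcone : ∀ F ∈ summingCone φ v, 0 ≤ m F := by
    intro F hF
    by_contra! hneg
    have hu := hm2 _ (smul_mem_summingCone (c := (|u| + 1) / (-m F))
      (div_nonneg (by positivity) (by linarith)) hF)
    rw [map_smul, smul_eq_mul, div_mul_eq_mul_div, le_div_iff₀ (by linarith)] at hu
    nlinarith [neg_abs_le u]
  have hu0 : u ≤ 0 := by simpa using hm2 0 ⟨[], fun t => by simp⟩
  have hm1' : 0 < m 1 := by
    have := hm1 (-1) ⟨1, one_pos, fun t => le_rfl⟩
    rw [map_neg] at this
    linarith
  refine ⟨(φ v ^ 2 / m 1) • m, fun x => ?_⟩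
  have h := hcone (φ v ^ 2 • (stateEval v x * stateEval v x) -
    (φ |(x : E)| ^ 2) • (1 : BoundedContinuousFunction (normalizedStates v) ℝ))
    ⟨[x], fun t => by simp [sq]⟩
  rw [map_sub, map_smul, map_smul, smul_eq_mul, smul_eq_mul, sub_nonneg] at h
  change _ ≤ φ v ^ 2 / m 1 * m (stateEval v x * stateEval v x)
  rw [div_mul_eq_mul_div, le_div_iff₀ hm1']
  exact h

theorem IsPositiveFunctional.exists_bilinear {φ : StrongDual ℝ E} (hφ : IsPositiveFunctional φ)
    {v : E} (hv : 0 ≤ v) :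
    ∃ B : principalIdeal v →ₗ[ℝ] principalIdeal v →ₗ[ℝ] ℝ, (∀ x y, B x y = B y x) ∧
      (∀ x : principalIdeal v, φ |(x : E)| ^ 2 ≤ B x x) ∧
      ∃ C, ∀ (x y : principalIdeal v) (c d : ℝ), 0 ≤ c → 0 ≤ d → |(x : E)| ≤ c • v →
        |(y : E)| ≤ d • v → |B x y| ≤ C * (c * d) := by
  rcases hv.eq_or_lt with rfl | hvpos
  · refine ⟨0, fun _ _ => rfl, ?_, 0, by simp⟩
    rintro ⟨x, c, -, hx⟩
    rw [smul_zero] at hx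
    have : |x| = 0 := le_antisymm hx (abs_nonneg x)
    simp [this]
  obtain ⟨f, hf, hfv, -⟩ := exists_positive_norming hv
  have hfv' : 0 < f v := hfv ▸ norm_pos_iff.2 hvpos.ne'
  have hT : (normalizedStates v).Nonempty := ⟨(f v)⁻¹ • f, fun x hx =>
    mul_nonneg (inv_nonneg.2 hfv'.le) (hf x hx), inv_mul_cancel₀ hfv'.ne'⟩
  obtain ⟨m, hm⟩ := hφ.exists_pietsch hv hT
  refine ⟨LinearMap.mk₂ ℝ (fun x y => m (stateEval v x * stateEval v y)) ?_ ?_ ?_ ?_,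
    fun x y => ?_, hm, ‖m‖, fun x y c d hc hd hx hy => ?_⟩
  · intro x y z; rw [map_add, add_mul, map_add]
  · intro c x y; rw [map_smul, smul_mul_assoc, map_smul]
  · intro x y z; rw [map_add, mul_add, map_add]
  · intro c x y; rw [map_smul, mul_smul_comm, map_smul]
  · simp [mul_comm]
  · rw [LinearMap.mk₂_apply, ← Real.norm_eq_abs]
    refine (m.le_opNorm _).trans ?_
    gcongr
    exact (norm_mul_le _ _).trans (mul_le_mul (norm_stateEval_le hc hx) (norm_stateEval_le hd hy)
      (norm_nonneg _) hc)

end Bilinear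

/-! ### Cauchy sequences through a semi-inner product. -/

theorem cauchySeq_of_forall_exists_abs_sub_le {a : ℕ → ℝ}
    (h : ∀ ε > 0, ∃ b : ℕ → ℝ, CauchySeq b ∧ ∀ n, |a n - b n| ≤ ε) : CauchySeq a := by
  rw [Metric.cauchySeq_iff]
  intro ε hε
  obtain ⟨b, hb, hab⟩ := h (ε / 4) (by positivity)
  obtain ⟨N, hN⟩ := Metric.cauchySeq_iff.1 hb (ε / 4) (by positivity)
  refine ⟨N, fun m hm n hn => ?_⟩
  have h1 := hN m hm n hn
  rw [Real.dist_eq] at h1 ⊢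
  have h2 := abs_le.1 (hab m)
  have h3 := abs_le.1 (hab n)
  have h4 := abs_lt.1 h1
  rw [abs_lt]
  constructor <;> linarith

section Bilinear

variable {V : Type*} [AddCommGroup V] [Module ℝ V]

/-- An approximate Riesz representation of a functional dominated by a semi-inner product. -/
theorem exists_mem_sq_sub_le {B : V →ₗ[ℝ] V →ₗ[ℝ] ℝ} (hsymm : ∀ x y, B x y = B y x)
    {g : V →ₗ[ℝ] ℝ} (hg : ∀ x, g x ^ 2 ≤ B x x) (S : Submodule ℝ V) {η : ℝ} (hη : 0 < η) :
    ∃ z ∈ S, ∀ x ∈ S, (g x - B z x) ^ 2 ≤ η * B x x := by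
  -- The Riesz variational functional. A minimizer up to η suffices, so no completeness is needed:
  -- near-minimality along z + t • x makes a quadratic in t nonnegative, and its discriminant gives
  -- the estimate.
  let J : V → ℝ := fun z => B z z - 2 * g z
  have hJ : BddBelow (J '' S) := by
    refine ⟨-1, ?_⟩
    rintro _ ⟨z, -, rfl⟩
    simp only [J]
    nlinarith [hg z, sq_nonneg (g z - 1)]
  obtain ⟨_, ⟨z, hz, rfl⟩, hlt⟩ := exists_lt_of_csInf_lt (⟨_, 0, S.zero_mem, rfl⟩ :
    (J '' S).Nonempty) (lt_add_of_pos_right _ hη)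
  refine ⟨z, hz, fun x hx => ?_⟩
  have hd : discrim (B x x) (2 * (B z x - g x)) η ≤ 0 := by
    refine discrim_le_zero fun t => ?_
    have h1 := csInf_le hJ ⟨z + t • x, S.add_mem hz (S.smul_mem t hx), rfl⟩
    simp only [J, map_add, map_smul, LinearMap.add_apply, LinearMap.smul_apply, smul_eq_mul,
      hsymm x z] at h1 hlt
    linarith
  rw [discrim] at hd
  nlinarith

/-- On the span of the y n, g is approximated by B z with z in that span, and B z (y (σ n)) is a
finite combination of the given Cauchy sequences. -/
theorem cauchySeq_of_sq_le_bilinear {B : V →ₗ[ℝ] V →ₗ[ℝ] ℝ} (hsymm : ∀ x y, B x y = B y x)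
    {g : V →ₗ[ℝ] ℝ} (hg : ∀ x, g x ^ 2 ≤ B x x) {y : ℕ → V} {R : ℝ} (hR : ∀ n, B (y n) (y n) ≤ R)
    {σ : ℕ → ℕ} (hσ : ∀ m, CauchySeq fun n => B (y m) (y (σ n))) :
    CauchySeq fun n => g (y (σ n)) := by
  have hR0 : 0 ≤ R := ((sq_nonneg _).trans (hg (y 0))).trans (hR 0)
  refine cauchySeq_of_forall_exists_abs_sub_le fun ε hε => ?_
  obtain ⟨z, hz, hzS⟩ := exists_mem_sq_sub_le hsymm hg (Submodule.span ℝ (Set.range y))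
    (η := ε ^ 2 / (R + 1)) (by positivity)
  refine ⟨fun n => B z (y (σ n)), ?_, fun n => ?_⟩
  · clear hzS
    induction hz using Submodule.span_induction with
    | mem x hx => obtain ⟨m, rfl⟩ := hx; exact hσ m
    | zero => simpa using cauchySeq_const (0 : ℝ)
    | add x w _ _ hx hw => simpa using! hx.add hw
    | smul c x _ hx => simpa using! (uniformContinuous_const_smul c).comp_cauchySeq hx
  · refine abs_le_of_sq_le_sq ((hzS _ (Submodule.subset_span ⟨σ n, rfl⟩)).trans ?_) hε.le
    rw [div_mul_eq_mul_div, div_le_iff₀ (by positivity)]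
    have := hR (σ n)
    gcongr
    linarith

end Bilinear

/-! ### Weakly Cauchy subsequences in order intervals. -/

section OrderInterval

variable {E : Type*} [NormedAddCommGroup E] [NormedSpace ℝ E]
  [Lattice E] [IsOrderedAddMonoid E] [HasSolidNorm E]

/-- Weak Cauchyness can be tested on positive functionals. -/
theorem isWeaklyCauchySeq_of_forall_positive {x : ℕ → E}
    (h : ∀ f : StrongDual ℝ E, IsPositiveFunctional f → CauchySeq fun n => f (x n)) :
    IsWeaklyCauchySeq x := by
  intro f
  obtain ⟨g, hg, hfg, -⟩ := exists_posPart_functional f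
  have h2 := h (g - f) fun x hx => sub_nonneg.2 (hfg x hx)
  have h3 := uniformContinuous_sub.comp_cauchySeq ((h g hg).prodMk h2)
  convert h3 using 2 with n
  exact (sub_sub_cancel _ _).symm

/-- Absolute continuity: a positive functional is, up to a small error on `[0, v]`, dominated by a
multiple of a control functional. -/
theorem IsPositiveFunctional.exists_sub_le_of_control {φ : StrongDual ℝ E}
    (hφ : IsPositiveFunctional φ) {v : E} (hv : 0 ≤ v)
    (hφv : ∀ ε > 0, ∃ δ > 0, ∀ y, 0 ≤ y → y ≤ v → φ y < δ → ‖y‖ ≤ ε)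
    {f : StrongDual ℝ E} (hf : IsPositiveFunctional f) {η : ℝ} (hη : 0 < η) :
    ∃ M ≥ 0, ∃ g : StrongDual ℝ E, IsPositiveFunctional g ∧ g v ≤ η ∧
      IsPositiveFunctional (f - g) ∧ ∀ x, 0 ≤ x → (f - g) x ≤ M * φ x := by
  obtain ⟨δ, hδ, h⟩ := hφv (η / (‖f‖ + 1)) (by positivity)
  have hM : 0 ≤ f v / δ := div_nonneg (hf v hv) hδ.le
  -- With M = f v / δ, g is the positive part of f - M φ. For y in [0, v], either φ y < δ and f y ≤
  -- η, or M φ y ≥ f v ≥ f y.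
  obtain ⟨g, hg, hfg, hgu⟩ := exists_posPart_functional (f - (f v / δ) • φ)
  have hap : ∀ y, (f - (f v / δ) • φ) y = f y - f v / δ * φ y := fun y => rfl
  refine ⟨f v / δ, hM, g, hg, hgu v η hv fun y hy0 hyv => ?_, fun x hx => ?_, fun x hx => ?_⟩
  · rw [hap]
    rcases lt_or_ge (φ y) δ with hlt | hge
    · have h1 := h y hy0 hyv hlt
      have h2 : f y ≤ ‖f‖ * (η / (‖f‖ + 1)) := (le_abs_self _).trans (f.le_opNorm_of_le h1)
      have h3 : ‖f‖ * (η / (‖f‖ + 1)) ≤ η := by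
        rw [← mul_div_assoc, div_le_iff₀ (by positivity)]
        nlinarith
      nlinarith [mul_nonneg hM (hφ y hy0)]
    · have h1 := mul_le_mul_of_nonneg_left hge hM
      rw [div_mul_cancel₀ _ hδ.ne'] at h1
      linarith [hf.mono hyv]
  · have := hgu x (f x) hx fun y hy0 hyx => by
      rw [hap]
      linarith [hf.mono hyx, mul_nonneg hM (hφ y hy0)]
    exact sub_nonneg.2 this
  · have := hfg x hx
    rw [hap] at this
    change f x - g x ≤ _
    linarith

variable [IsOrderedModule ℝ E] [CompleteSpace E]

theorem HasOrderContinuousNorm.exists_subseq_isWeaklyCauchySeq (hE : HasOrderContinuousNorm E)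
    {v : E} (hv : 0 ≤ v) {y : ℕ → ℕ → E} (hy : ∀ k, ∃ c : ℝ, 0 ≤ c ∧ ∀ n, |y k n| ≤ c • v) :
    ∃ σ : ℕ → ℕ, StrictMono σ ∧ ∀ k, IsWeaklyCauchySeq (y k ∘ σ) := by
  choose c hc hyc using hy
  obtain ⟨φ, hφ, hφv⟩ := hE.exists_control_functional v
  obtain ⟨B, hsymm, hφB, C, hC⟩ := hφ.exists_bilinear hv
  let Y : ℕ → ℕ → principalIdeal v := fun k n => ⟨y k n, c k, hc k, hyc k n⟩
  have hBY : ∀ k m n, |B (Y k m) (Y k n)| ≤ C * (c k * c k) := fun k m n =>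
    hC _ _ _ _ (hc k) (hc k) (hyc k m) (hyc k n)
  -- Compactness of a countable product of intervals yields one σ for all pairs (k, m), hence for
  -- all the sequences y k at once.
  obtain ⟨_, -, σ, hσ, hlim⟩ := (isCompact_univ_pi (X := fun _ : ℕ × ℕ => ℝ)
    fun p => isCompact_Icc (a := -(C * (c p.1 * c p.1))) (b := C * (c p.1 * c p.1))).tendsto_subseq
    (x := fun n p => B (Y p.1 p.2) (Y p.1 n)) fun n p _ => abs_le.1 (hBY p.1 p.2 n)
  have hcau : ∀ k m, CauchySeq fun n => B (Y k m) (Y k (σ n)) := fun k m =>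
    (tendsto_pi_nhds.1 hlim (k, m)).cauchySeq
  refine ⟨σ, hσ, fun k => ?_⟩
  refine isWeaklyCauchySeq_of_forall_positive fun f hf => ?_
  refine cauchySeq_of_forall_exists_abs_sub_le fun ε hε => ?_
  obtain ⟨M, hM, g, hg, hgv, hfg, hfgM⟩ := hφ.exists_sub_le_of_control hv hφv hf
    (η := ε / (c k + 1)) (div_pos hε (by linarith [hc k]))
  refine ⟨fun n => (f - g) (y k (σ n)), ?_, fun n => ?_⟩
  · refine cauchySeq_of_sq_le_bilinear (B := M ^ 2 • B) (y := Y k)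
      (g := (f - g).toLinearMap ∘ₗ (principalIdeal v).subtype) (R := M ^ 2 * (C * (c k * c k)))
      (fun x w => ?_) (fun x => ?_) (fun n => ?_) (fun m => ?_)
    · simp [hsymm x w]
    · have h1 : |(f - g) x| ≤ M * φ |(x : E)| :=
        (hfg.abs_le x).trans (hfgM _ (abs_nonneg _))
      have h2 := pow_le_pow_left₀ (abs_nonneg _) h1 2
      rw [sq_abs, mul_pow] at h2
      exact h2.trans (mul_le_mul_of_nonneg_left (hφB x) (sq_nonneg M))
    · exact mul_le_mul_of_nonneg_left ((le_abs_self _).trans (hBY k n n)) (sq_nonneg M)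
    · exact (uniformContinuous_const_smul (M ^ 2)).comp_cauchySeq (hcau k m)
  · have e : f (y k (σ n)) - (f - g) (y k (σ n)) = g (y k (σ n)) := sub_sub_cancel _ _
    change |f (y k (σ n)) - (f - g) (y k (σ n))| ≤ ε
    rw [e]
    refine (hg.abs_le _).trans ((hg.mono (hyc k _)).trans ?_)
    have h1 := mul_le_mul_of_nonneg_left hgv (hc k)
    rw [map_smul, smul_eq_mul]
    refine h1.trans ?_
    rw [← mul_div_assoc, div_le_iff₀ (by linarith [hc k])]
    nlinarith [hc k]

end OrderInterval

/-! ### Disjointness and truncation estimates. -/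

section LatticeGroup

variable {E : Type*} [AddCommGroup E] [Lattice E] [IsOrderedAddMonoid E]

theorem sub_inf_le_posPart_sub {x u : E} (hu : 0 ≤ u) : x⁺ - x⁺ ⊓ u ≤ (x - u)⁺ := by
  refine sub_inf_le_of_le_add (posPart_nonneg _) ?_
  rw [posPart_def]
  refine sup_le ?_ (add_nonneg hu (posPart_nonneg _))
  exact sub_le_iff_le_add'.1 (le_posPart _)

theorem inf_sum_le_sum_inf {ι : Type*} {u : E} (hu : 0 ≤ u) (s : Finset ι) {z : ι → E}
    (hz : ∀ i, 0 ≤ z i) : u ⊓ ∑ i ∈ s, z i ≤ ∑ i ∈ s, u ⊓ z i := by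
  classical
  induction s using Finset.induction_on with
  | empty => simp
  | insert a s ha ih =>
    rw [Finset.sum_insert ha, Finset.sum_insert ha, inf_comm]
    refine (add_inf_le_inf_add_inf (hz a) (Finset.sum_nonneg fun i _ => hz i) hu).trans ?_
    rw [inf_comm (z a), inf_comm _ u]
    exact add_le_add le_rfl ih

theorem inf_nsmul_le_zero {u w : E} (hu : 0 ≤ u) (hw : 0 ≤ w) (h : u ⊓ w ≤ 0) (m : ℕ) :
    u ⊓ m • w ≤ 0 := by
  have := inf_sum_le_sum_inf hu (Finset.range m) (z := fun _ => w) fun _ => hw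
  rw [Finset.sum_const, Finset.card_range, Finset.sum_const] at this
  exact this.trans (nsmul_nonpos h _)

/-- A Chebyshev inequality: k • v ≤ |x| + (x - k • v)⁻, and the last term is disjoint from (x - k •
v)⁺. So v has size at most |x| / k on the carrier of the excess. -/
theorem nsmul_inf_nsmul_posPart_sub_le {v x : E} (k m : ℕ) :
    k • (v ⊓ m • (x - k • v)⁺) ≤ |x| := by
  set w := (x - k • v)⁺ with hw
  set z := (x - k • v)⁻ with hz
  have hw0 : 0 ≤ w := posPart_nonneg _
  have hz0 : 0 ≤ z := negPart_nonneg _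
  have h1 : k • v ≤ |x| + z := by
    have e : k • v = x + -(x - k • v) := by abel
    rw [e]
    exact add_le_add (le_abs_self x) (neg_le_negPart _)
  calc k • (v ⊓ m • w) ≤ (|x| + z) ⊓ ((k * m) • w) := le_inf
        ((nsmul_le_nsmul_right inf_le_left k).trans h1)
        ((nsmul_le_nsmul_right inf_le_right k).trans_eq (mul_nsmul' w k m).symm)
    _ ≤ |x| ⊓ ((k * m) • w) + z ⊓ ((k * m) • w) :=
        add_inf_le_inf_add_inf (abs_nonneg x) hz0 (nsmul_nonneg hw0 _)
    _ ≤ |x| + 0 := add_le_add inf_le_left (inf_nsmul_le_zero hz0 hw0 (by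
        rw [inf_comm, posPart_inf_negPart_eq_zero]) _)
    _ = |x| := add_zero _

end LatticeGroup

/-! ### Uniform truncation of V*-sequences. -/

section VStar

variable {E : Type*} [NormedAddCommGroup E] [NormedSpace ℝ E]
  [Lattice E] [IsOrderedAddMonoid E] [HasSolidNorm E]

/-- Every finite signed sum of the F j is dominated by f, so its norm is at most ‖f‖; choosing the
signs of ψ (F j) bounds the sums of |ψ (F j)|. -/
theorem isWeaklyUnconditionallyCauchy_of_sum_le {F : ℕ → StrongDual ℝ E} {f : StrongDual ℝ E}
    (hF : ∀ j, IsPositiveFunctional (F j))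
    (hle : ∀ n x, 0 ≤ x → ∑ j ∈ Finset.range n, F j x ≤ f x) :
    IsWeaklyUnconditionallyCauchy F := by
  intro ψ
  refine summable_of_sum_le (c := ‖ψ‖ * ‖f‖) (fun j => abs_nonneg _) fun u => ?_
  let s : ℕ → ℝ := fun j => if 0 ≤ ψ (F j) then 1 else -1
  have hs : ∀ j, |s j| = 1 := fun j => by simp only [s]; split_ifs <;> simp
  have hsψ : ∀ j, s j * ψ (F j) = |ψ (F j)| := fun j => by
    simp only [s]
    split_ifs with h
    · rw [one_mul, abs_of_nonneg h]
    · rw [abs_of_neg (not_le.1 h)]; ring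
  have e : ∑ j ∈ u, |ψ (F j)| = ψ (∑ j ∈ u, s j • F j) := by
    rw [map_sum]
    exact Finset.sum_congr rfl fun j _ => by rw [map_smul, smul_eq_mul, hsψ]
  rw [e]
  refine (le_abs_self _).trans (ψ.le_opNorm_of_le ?_)
  refine ContinuousLinearMap.opNorm_le_bound _ (norm_nonneg f) fun x => ?_
  obtain ⟨n, hn⟩ := u.exists_nat_subset_range
  calc ‖(∑ j ∈ u, s j • F j) x‖ = |∑ j ∈ u, s j * F j x| := by
        rw [Real.norm_eq_abs, sum_apply]; rfl
    _ ≤ ∑ j ∈ u, |s j * F j x| := Finset.abs_sum_le_sum_abs _ _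
    _ ≤ ∑ j ∈ u, F j |x| := Finset.sum_le_sum fun j _ => by
        rw [abs_mul, hs, one_mul]; exact (hF j).abs_le x
    _ ≤ ∑ j ∈ Finset.range n, F j |x| :=
        Finset.sum_le_sum_of_subset_of_nonneg hn fun j _ _ => hF j _ (abs_nonneg x)
    _ ≤ f |x| := hle n _ (abs_nonneg x)
    _ ≤ ‖f‖ * ‖x‖ := by
        rw [← norm_abs_eq_norm x]
        exact (le_abs_self _).trans (f.le_opNorm _)

/-- A sequence in a V*-set is uniformly almost order bounded with respect to every positive
functional. -/
theorem IsPositiveFunctional.exists_forall_apply_posPart_sub_le {x : ℕ → E} {R : ℝ}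
    (hR : ∀ n, ‖x n‖ ≤ R)
    (hV : ∀ F : ℕ → StrongDual ℝ E, IsWeaklyUnconditionallyCauchy F → ∀ ε > 0,
      ∃ j, ∀ n, |F j (x n)| ≤ ε)
    {v : E} (hv : 0 ≤ v) (hxv : ∀ n, ∃ c : ℝ, 0 ≤ c ∧ |x n| ≤ c • v)
    {f : StrongDual ℝ E} (hf : IsPositiveFunctional f) {ε : ℝ} (hε : 0 < ε) :
    ∃ k : ℕ, ∀ n, ∀ l ≥ k, f ((x n - l • v)⁺) ≤ ε := by
  suffices h : ∃ k : ℕ, ∀ n, f ((x n - k • v)⁺) ≤ ε by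
    obtain ⟨k, hk⟩ := h
    exact ⟨k, fun n l hl => (hf.mono (posPart_mono
      (sub_le_sub_left (nsmul_le_nsmul_left hv hl) _))).trans (hk n)⟩
  by_contra! hcon
  choose N hN using hcon
  choose c hc hxc using hxv
  -- In the recursion for `κ`, doubling makes the bounds on v geometric, and `G` makes the next
  -- carrier part at most ε/2 on (X j)⁺.
  let G : ℕ → ℕ := fun k => ⌈4 * c (N k) * (‖f‖ * R) / ε⌉₊
  obtain ⟨κ, hκz, hκs⟩ : ∃ κ : ℕ → ℕ, κ 0 = 1 ∧ ∀ j, κ (j + 1) = 2 * κ j + G (κ j) + 1 :=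
    ⟨fun j => Nat.rec 1 (fun _ k => 2 * k + G k + 1) j, rfl, fun _ => rfl⟩
  have hκ1 : ∀ j, 1 ≤ κ j := fun j => by
    cases j with
    | zero => exact hκz.ge
    | succ j => rw [hκs]; omega
  have hκ0 : ∀ j, (0 : ℝ) < (κ j : ℝ) := fun j => by exact_mod_cast hκ1 j
  have hκ2 : ∀ j i : ℕ, 2 ^ i * (κ j : ℝ) ≤ κ (j + i) := by
    intro j i
    induction i with
    | zero => simp
    | succ i ih =>
      have : (2 * κ (j + i) : ℝ) ≤ κ (j + (i + 1)) := by
        rw [← add_assoc, hκs]; push_cast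
        linarith [(G (κ (j + i))).cast_nonneg (α := ℝ)]
      rw [pow_succ]; linarith
  let X : ℕ → E := fun j => x (N (κ j))
  let w : ℕ → E := fun j => (X j - κ j • v)⁺
  have hw0 : ∀ j, 0 ≤ w j := fun j => posPart_nonneg _
  have hwf : ∀ j, ε < f (w j) := fun j => hN (κ j)
  have hwX : ∀ j, w j ≤ (X j)⁺ := fun j => posPart_mono (sub_le_self _ (nsmul_nonneg hv _))
  let S : ℕ → ℕ → E := fun j m => ∑ i ∈ Finset.range m, w (j + i)
  have hS0 : ∀ j m, 0 ≤ S j m := fun j m => Finset.sum_nonneg fun i _ => hw0 _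
  have hSmono : ∀ j, Monotone (S j) := fun j m n hmn =>
    Finset.sum_le_sum_of_subset_of_nonneg (Finset.range_mono hmn) fun i _ _ => hw0 _
  have hSs : ∀ j m, S j (m + 1) = S (j + 1) m + w j := fun j m => by
    simp only [S]
    rw [Finset.sum_range_succ', add_zero]
    congr 1
    exact Finset.sum_congr rfl fun i _ => by congr 1; omega
  let a : ℕ → ℕ → E := fun j m => m • S j m
  have ha0 : ∀ j m, 0 ≤ a j m := fun j m => nsmul_nonneg (hS0 j m) m
  have hamono : ∀ j, Monotone (a j) := fun j m n hmn =>
    (nsmul_le_nsmul_right (hSmono j hmn) m).trans (nsmul_le_nsmul_left (hS0 j n) hmn)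
  have hadouble : ∀ j m, ∃ n, a j m + a j m ≤ a j n := fun j m => ⟨2 * m, by
    simp only [a]
    rw [← add_nsmul, ← two_mul]
    exact nsmul_le_nsmul_right (hSmono j (by omega)) _⟩
  -- `P j` is the part of f carried by the excesses w i with i ≥ j.
  choose P hP using fun j => hf.exists_carrier (hamono j) (ha0 j) (hadouble j)
  have hPpos : ∀ j, IsPositiveFunctional (P j) := fun j y hy =>
    (hf _ (le_inf hy (ha0 j 0))).trans ((hP j y hy).1 ⟨0, rfl⟩)
  have hPf : ∀ j y, 0 ≤ y → P j y ≤ f y := fun j y hy => (hP j y hy).2 (by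
    rintro _ ⟨m, rfl⟩; exact hf.mono inf_le_left)
  have hPanti : ∀ j y, 0 ≤ y → P (j + 1) y ≤ P j y := fun j y hy => (hP (j + 1) y hy).2 (by
    rintro _ ⟨m, rfl⟩
    refine (hf.mono (inf_le_inf_left y ?_)).trans ((hP j y hy).1 ⟨m + 1, rfl⟩)
    refine (nsmul_le_nsmul_left (hS0 _ _) m.le_succ).trans (nsmul_le_nsmul_right ?_ _)
    rw [hSs]
    exact le_add_of_nonneg_right (hw0 j))
  -- Passing from `P (j + 1)` to `P j` adds only the carrier of w j, which is disjoint from (X j)⁻.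
  have hPneg : ∀ j, P j (X j)⁻ ≤ P (j + 1) (X j)⁻ := fun j => (hP j _ (negPart_nonneg _)).2 (by
    rintro _ ⟨m, rfl⟩
    have h1 : (X j)⁻ ⊓ a j m ≤ (X j)⁻ ⊓ a (j + 1) m := by
      have h2 : a j m ≤ a (j + 1) m + m • w j := by
        simp only [a]
        rw [← nsmul_add, ← hSs]
        exact nsmul_le_nsmul_right (hSmono j m.le_succ) m
      have h3 : (X j)⁻ ⊓ m • w j ≤ 0 := inf_nsmul_le_zero (negPart_nonneg _) (hw0 j) (by
        refine (inf_le_inf_left _ (hwX j)).trans_eq ?_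
        rw [inf_comm, posPart_inf_negPart_eq_zero]) m
      refine (inf_le_inf_left _ h2).trans ?_
      rw [inf_comm]
      refine (add_inf_le_inf_add_inf (ha0 _ _) (nsmul_nonneg (hw0 j) m)
        (negPart_nonneg _)).trans ?_
      rw [inf_comm, inf_comm _ (X j)⁻]
      exact (add_le_add le_rfl h3).trans_eq (add_zero _)
    exact (hf.mono h1).trans ((hP (j + 1) _ (negPart_nonneg _)).1 ⟨m, rfl⟩))
  have hfX : ∀ j, f |X j| ≤ ‖f‖ * R := fun j => (le_abs_self _).trans
    (f.le_opNorm_of_le ((norm_abs_eq_norm _).trans_le (hR _)))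
  have hfR : 0 ≤ ‖f‖ * R := (hf _ (abs_nonneg _)).trans (hfX 0)
  have hPv : ∀ j, P j v ≤ 2 * (‖f‖ * R) / κ j := fun j => (hP j v hv).2 (by
    rintro _ ⟨m, rfl⟩
    have h1 : v ⊓ a j m ≤ ∑ i ∈ Finset.range m, v ⊓ m • w (j + i) := by
      simp only [a, S]
      rw [← Finset.sum_nsmul]
      exact inf_sum_le_sum_inf hv _ fun i => nsmul_nonneg (hw0 _) _
    refine (hf.mono h1).trans ?_
    rw [map_sum]
    calc ∑ i ∈ Finset.range m, f (v ⊓ m • w (j + i))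
        ≤ ∑ i ∈ Finset.range m, (‖f‖ * R) / κ j * (1 / 2 : ℝ) ^ i :=
          Finset.sum_le_sum fun i _ => by
            have h2 := hf.mono (nsmul_inf_nsmul_posPart_sub_le (v := v) (x := X (j + i))
              (κ (j + i)) m)
            rw [map_nsmul, nsmul_eq_mul] at h2
            have h3 : f (v ⊓ m • w (j + i)) * κ (j + i) ≤ ‖f‖ * R := by
              rw [mul_comm]; exact h2.trans (hfX _)
            have h4 : 0 ≤ f (v ⊓ m • w (j + i)) := hf _ (le_inf hv (nsmul_nonneg (hw0 _) _))
            rw [div_mul_eq_mul_div, one_div, inv_pow, le_div_iff₀ (hκ0 j),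
              ← div_eq_mul_inv, le_div_iff₀ (by positivity)]
            refine le_trans ?_ h3
            rw [mul_assoc, mul_comm (κ j : ℝ)]
            exact mul_le_mul_of_nonneg_left (hκ2 j i) h4
      _ = (‖f‖ * R) / κ j * ∑ i ∈ Finset.range m, (1 / 2 : ℝ) ^ i := by rw [Finset.mul_sum]
      _ ≤ (‖f‖ * R) / κ j * 2 :=
          mul_le_mul_of_nonneg_left (sum_geometric_two_le m) (div_nonneg hfR (hκ0 j).le)
      _ = 2 * (‖f‖ * R) / κ j := by ring)
  have hPX : ∀ j, P (j + 1) (X j)⁺ ≤ ε / 2 := fun j => by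
    have h1 : P (j + 1) (X j)⁺ ≤ c (N (κ j)) * P (j + 1) v := by
      have := (hPpos (j + 1)).mono
        ((sup_le (le_abs_self (X j)) (abs_nonneg (X j))).trans (hxc (N (κ j))))
      rwa [map_smul, smul_eq_mul] at this
    have h2 : 4 * c (N (κ j)) * (‖f‖ * R) / ε ≤ κ (j + 1) := by
      refine (Nat.le_ceil _).trans ?_
      exact_mod_cast (by rw [hκs]; simp only [G]; omega : G (κ j) ≤ κ (j + 1))
    refine h1.trans ((mul_le_mul_of_nonneg_left (hPv (j + 1)) (hc _)).trans ?_)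
    rw [div_le_iff₀ hε] at h2
    rw [← mul_div_assoc, div_le_iff₀ (hκ0 _)]
    linarith
  have hwuc : IsWeaklyUnconditionallyCauchy fun j => P j - P (j + 1) := by
    refine isWeaklyUnconditionallyCauchy_of_sum_le (f := f)
      (fun j y hy => sub_nonneg.2 (hPanti j y hy)) fun n y hy => ?_
    have : ∑ j ∈ Finset.range n, (P j - P (j + 1)) y = P 0 y - P n y :=
      Finset.sum_range_sub' (fun j => P j y) n
    rw [this]
    linarith [hPf 0 y hy, hPpos n y hy]
  -- The difference P j - P (j + 1) exceeds ε - ε/2 at X j: `P j` sees w j, `P (j + 1)` is small on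
  -- (X j)⁺, and (X j)⁻ contributes no loss.
  obtain ⟨j, hj⟩ := hV _ hwuc (ε / 4) (by positivity)
  have h1 := (le_abs_self _).trans (hj (N (κ j)))
  have h2 : (P j - P (j + 1)) (X j) =
      (P j (X j)⁺ - P (j + 1) (X j)⁺) - (P j (X j)⁻ - P (j + 1) (X j)⁻) := by
    conv_lhs => rw [← posPart_sub_negPart (X j)]
    rw [map_sub]; rfl
  have h3 : f (w j) ≤ P j (X j)⁺ := by
    refine (hf.mono (le_inf (hwX j) ?_)).trans ((hP j _ (posPart_nonneg _)).1 ⟨1, rfl⟩)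
    simp [a, S]
  have h4 : (P j - P (j + 1)) (X j) ≤ ε / 4 := h1
  rw [h2] at h4
  linarith [hwf j, hPneg j, hPX j]

end VStar

/-! ### Truncation and the passage to subspaces. -/

section Main

variable {E : Type*} [NormedAddCommGroup E] [NormedSpace ℝ E] [CompleteSpace E]
  [Lattice E] [IsOrderedAddMonoid E] [IsOrderedModule ℝ E] [HasSolidNorm E]

/-- Every bounded sequence lies in the order ideal generated by a single element. -/
theorem exists_forall_abs_le_smul {x : ℕ → E} {R : ℝ} (hR : ∀ n, ‖x n‖ ≤ R) :
    ∃ v : E, 0 ≤ v ∧ ∀ n, ∃ c : ℝ, 0 ≤ c ∧ |x n| ≤ c • v := by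
  have hp : ∀ n : ℕ, (0 : ℝ) < (1 / 2) ^ n := fun n => by positivity
  have hsum : Summable fun n => ((1 / 2 : ℝ) ^ n) • |x n| := by
    refine Summable.of_norm_bounded (summable_geometric_two.mul_right R) fun n => ?_
    rw [norm_smul, norm_abs_eq_norm, Real.norm_of_nonneg (hp n).le]
    exact mul_le_mul_of_nonneg_left (hR n) (hp n).le
  have h0 : ∀ n, 0 ≤ ((1 / 2 : ℝ) ^ n) • |x n| := fun n => smul_nonneg (hp n).le (abs_nonneg _)
  refine ⟨∑' n, ((1 / 2 : ℝ) ^ n) • |x n|, tsum_nonneg h0, fun n =>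
    ⟨((1 / 2 : ℝ) ^ n)⁻¹, (inv_pos.2 (hp n)).le, ?_⟩⟩
  rw [le_inv_smul_iff_of_pos (hp n)]
  exact hsum.le_tsum n fun m _ => h0 m

theorem HasOrderContinuousNorm.exists_subseq_of_vStar (hE : HasOrderContinuousNorm E)
    {x : ℕ → E} {R : ℝ} (hR : ∀ n, ‖x n‖ ≤ R)
    (hV : ∀ F : ℕ → StrongDual ℝ E, IsWeaklyUnconditionallyCauchy F → ∀ ε > 0,
      ∃ j, ∀ n, |F j (x n)| ≤ ε) :
    ∃ σ : ℕ → ℕ, StrictMono σ ∧ IsWeaklyCauchySeq (x ∘ σ) := by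
  obtain ⟨v, hv, hxv⟩ := exists_forall_abs_le_smul hR
  -- Truncations of x n to [-k • v, k • v]; the positive and negative parts of the error each cost
  -- at most ε/2 under f.
  let y : ℕ → ℕ → E := fun k n => (x n)⁺ ⊓ k • v - (-x n)⁺ ⊓ k • v
  have hy : ∀ k, ∃ c : ℝ, 0 ≤ c ∧ ∀ n, |y k n| ≤ c • v := fun k => ⟨k, k.cast_nonneg, fun n => by
    rw [Nat.cast_smul_eq_nsmul]
    have h1 : ∀ z : E, 0 ≤ z⁺ ⊓ k • v := fun z => le_inf (posPart_nonneg z) (nsmul_nonneg hv k)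
    refine abs_le'.2 ⟨(sub_le_self _ (h1 _)).trans inf_le_right, ?_⟩
    rw [neg_sub]
    exact (sub_le_self _ (h1 _)).trans inf_le_right⟩
  obtain ⟨σ, hσ, hcau⟩ := hE.exists_subseq_isWeaklyCauchySeq hv hy
  refine ⟨σ, hσ, isWeaklyCauchySeq_of_forall_positive fun f hf => ?_⟩
  refine cauchySeq_of_forall_exists_abs_sub_le fun ε hε => ?_
  obtain ⟨k₁, h₁⟩ := hf.exists_forall_apply_posPart_sub_le hR hV hv hxv (half_pos hε)
  obtain ⟨k₂, h₂⟩ := hf.exists_forall_apply_posPart_sub_le (x := fun n => -x n) (R := R)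
    (fun n => by rw [norm_neg]; exact hR n)
    (fun F hF ε hε => by simpa only [map_neg, abs_neg] using hV F hF ε hε) hv
    (fun n => by simpa only [abs_neg] using hxv n) (half_pos hε)
  let k := max k₁ k₂
  refine ⟨fun n => f (y k (σ n)), hcau k f, fun n => ?_⟩
  have hk : 0 ≤ k • v := nsmul_nonneg hv k
  set z := x (σ n) with hz
  have e : f z - f (y k (σ n)) = f (z⁺ - z⁺ ⊓ k • v) - f ((-z)⁺ - (-z)⁺ ⊓ k • v) := by
    rw [← map_sub, ← map_sub]
    congr 1
    simp only [y, ← hz]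
    have ez : z⁺ - (-z)⁺ = z := by rw [posPart_neg, posPart_sub_negPart]
    nth_rw 1 [← ez]
    abel
  have b1 := (hf.mono (sub_inf_le_posPart_sub (x := z) hk)).trans
    (h₁ (σ n) k (le_max_left _ _))
  have b2 := (hf.mono (sub_inf_le_posPart_sub (x := -z) hk)).trans
    (h₂ (σ n) k (le_max_right _ _))
  have b3 := hf _ (sub_nonneg.2 (inf_le_left : z⁺ ⊓ k • v ≤ z⁺))
  have b4 := hf _ (sub_nonneg.2 (inf_le_left : (-z)⁺ ⊓ k • v ≤ (-z)⁺))
  change |f z - f (y k (σ n))| ≤ ε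
  rw [e, abs_le]
  constructor <;> linarith

end Main

theorem mainTheorem3 {E : Type*} [NormedAddCommGroup E] [NormedSpace ℝ E] [CompleteSpace E]
    [Lattice E] [IsOrderedAddMonoid E] [IsOrderedModule ℝ E] [HasSolidNorm E]
    (hE : HasOrderContinuousNorm E) (X : Submodule ℝ E) (hX : IsClosed (X : Set E)) :
    HasPropertyWeakVStar X := by
  rintro K ⟨hK, hV⟩ x hx
  obtain ⟨R, hR⟩ := hK.exists_norm_le
  obtain ⟨σ, hσ, hcau⟩ := hE.exists_subseq_of_vStar (x := fun n => (x n : E)) (R := R)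
    (fun n => hR _ (hx n)) (fun F hF ε hε => by
      let G : ℕ → StrongDual ℝ X := fun j => (F j).comp X.subtypeL
      have hG : IsWeaklyUnconditionallyCauchy G := fun ψ =>
        hF (ψ.comp ((ContinuousLinearMap.compL ℝ X E ℝ).flip X.subtypeL))
      obtain ⟨j, hj⟩ := ((hV G hG).eventually (gt_mem_nhds hε)).exists
      refine ⟨j, fun n => le_trans ?_ hj.le⟩
      have hbdd : BddAbove (Set.range fun z : K => |G j (z : X)|) := by
        refine ⟨‖G j‖ * R, ?_⟩
        rintro _ ⟨z, rfl⟩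
        exact (G j).le_opNorm_of_le (hR _ z.2)
      exact le_ciSup hbdd ⟨x n, hx n⟩)
  refine ⟨σ, hσ, fun f => ?_⟩
  obtain ⟨g, hg, -⟩ := exists_extension_norm_eq X f
  simpa [Function.comp_def, hg] using hcau g
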